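/- Let $L\ge 1$ be an integer, $0<\alpha<1$, and let $\{0,1\}^L$ be the set of configurations $x=(x_j)_{j\in\mathbb Z/L\mathbb Z}$ on the periodic lattice of length $L$. Consider the Markov chain $(v^n)_{n\ge0}$ on $\{0,1\}^L$ given by $$v_j^{n+1}=v_j^n+q(v_{j-3}^n,v_{j-2}^n,v_{j-1}^n,v_j^n)-q(v_{j-2}^n,v_{j-1}^n,v_j^n,v_{j+1}^n),$$ where $q(1,0,1,0)=q(0,0,1,0)=1$, $q(1,1,1,0)=b$, and $q(w,x,y,z)=0$ for all other $(w,x,y,z)\in\{0,1\}^4$. Here $b$ is a random variable equal to $1$ with probability $\alpha$ and to $0$ with probability $1-\alpha$. There is one such variable $b_j^n$ for each site $j\in\mathbb Z/L\mathbb Z$ and each time $n$, all of them independent (and independent of $v^0$); $b_j^n$ is used in $q(v_{j-2}^n,v_{j-1}^n,v_j^n,v_{j+1}^n)$ wherever this flux occurs, i.e. in the equations for both $v_j^{n+1}$ and $v_{j+1}^{n+1}$. Let $f_n(x',x)$ be the $n$-step transition probabilities and $f=f_1$. A set $\Omega\subset\{0,1\}^L$ is irreducible if for all $x',x\in\Omega$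 there is an $n\ge0$ with $f_n(x',x)>0$; an irreducible component is a maximal irreducible set. For a word $a_1\cdots a_k$, let $\#a_1\cdots a_k(x)$ be the number of sites $j\in\mathbb Z/L\mathbb Z$ with $x_jx_{j+1}\cdots x_{j+k-1}=a_1\cdots a_k$ (indices modulo $L$). **Theorem.** Let $\Omega$ be an irreducible component of this Markov chain. Then there is exactly one probability vector $p$ on $\{0,1\}^L$ that vanishes outside $\Omega$ and is stationary, i.e. $\sum_{x'}f(x',x)p(x')=p(x)$ for all $x\in\{0,1\}^L$. For every $x\in\Omega$ it satisfies $$p(x)=\frac{\dfrac{\alpha^{\#010(x)}}{(1-\alpha)^{\#1110(x)+\#010(x)}}}{\displaystyle\sum_{k_1,k_2\ge0}\frac{\alpha^{k_2}}{(1-\alpha)^{k_1+k_2}}N_\Omega(k_1,k_2)},$$ where $N_\Omega(k_1,k_2)$ is the number of configurations $x\in\Omega$ with $\#1110(x)=k_1$ and $\#010(x)=k_2$. -/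

import Mathlib

open scoped BigOperators

namespace FiveNeighborCA

/-- Configurations in `{0,1}^L` on the periodic lattice `ℤ/Lℤ` (`true` is `1`, `false` is `0`). -/
abbrev Config (L : ℕ) : Type := ZMod L → Bool

/-- The flux `q(w,x,y,z)`; `b` is the value of the random variable that enters for `1110`. -/
def flux (b : Bool) : Bool → Bool → Bool → Bool → ℤ
  | true, true, true, false => b.toInt
  | true, false, true, false => 1
  | false, false, true, false => 1
  | _, _, _, _ => 0

/-- The flux `q(v_{j-2}, v_{j-1}, v_j, v_{j+1})` from site `j` to site `j + 1`; the noise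
variable used for this bond is `b j`. -/
def bondFlux {L : ℕ} (b : ZMod L → Bool) (v : Config L) (j : ZMod L) : ℤ :=
  flux (b j) (v (j - 2)) (v (j - 1)) (v j) (v (j + 1))

/-- The configuration at time `n + 1`, given the configuration `v` at time `n` and the values `b`
of the noise: site `j` carries the value
`v_j + q(v_{j-3}, v_{j-2}, v_{j-1}, v_j) - q(v_{j-2}, v_{j-1}, v_j, v_{j+1})`,
which lies in `{0,1}` by `update_toInt` below. -/
def update {L : ℕ} (b : ZMod L → Bool) (v : Config L) : Config L := fun j =>
  decide ((v j).toInt + bondFlux b v (j - 1) - bondFlux b v j = 1)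

theorem update_toInt {L : ℕ} (b : ZMod L → Bool) (v : Config L) (j : ZMod L) :
    (update b v j).toInt = (v j).toInt + bondFlux b v (j - 1) - bondFlux b v j := by
  have h1 : j - 1 - 2 = j - 3 := by ring
  have h2 : j - 1 - 1 = j - 2 := by ring
  have h3 : j - 1 + 1 = j := by ring
  simp only [update, bondFlux, h1, h2, h3]
  generalize v (j - 3) = p3
  generalize v (j - 2) = p2
  generalize v (j - 1) = p1
  generalize v j = p0
  generalize v (j + 1) = n1
  generalize b (j - 1) = c
  generalize b j = d
  revert p3 p2 p1 p0 n1 c d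
  decide

/-- The probability that the independent noise variables, one for each bond, each equal to `1`
with probability `α` and to `0` with probability `1 - α`, take the values `b`. -/
noncomputable def noiseProb {L : ℕ} [NeZero L] (α : ℝ) (b : ZMod L → Bool) : ℝ :=
  ∏ j, if b j then α else 1 - α

/-- The transition matrix: the entry `(x', x)` is the one-step probability `f(x', x)` to go
from `x'` to `x`, i.e. the probability that the noise `b` satisfies `update b x' = x`. -/
noncomputable def transition (L : ℕ) [NeZero L] (α : ℝ) : Matrix (Config L) (Config L) ℝ :=
  Matrix.of fun x' x => ∑ b : ZMod L → Bool, if update b x' = x then noiseProb α b else 0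

/-- The `n`-step transition probability `f_n(x', x)`. -/
noncomputable def stepProb {L : ℕ} [NeZero L] (α : ℝ) (n : ℕ) (x' x : Config L) : ℝ :=
  (transition L α ^ n) x' x

/-- `Ω` is irreducible: any two of its members lead to each other with positive probability. -/
def IsIrreducible {L : ℕ} [NeZero L] (α : ℝ) (Ω : Set (Config L)) : Prop :=
  ∀ x' ∈ Ω, ∀ x ∈ Ω, ∃ n : ℕ, 0 < stepProb α n x' x

/-- The irreducible components (irreducible classes) are the maximal irreducible sets. -/
def IsIrreducibleComponent {L : ℕ} [NeZero L] (α : ℝ) (Ω : Set (Config L)) : Prop :=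
  Maximal (IsIrreducible α) Ω

/-- `p` is a probability vector on `{0,1}^L`, supported on `Ω`, and stationary for the chain. -/
structure IsStationaryOn {L : ℕ} [NeZero L] (α : ℝ) (Ω : Set (Config L))
    (p : Config L → ℝ) : Prop where
  nonneg : ∀ x, 0 ≤ p x
  sum_eq_one : ∑ x, p x = 1
  stationary : ∀ x, ∑ x', transition L α x' x * p x' = p x
  support : ∀ x, x ∉ Ω → p x = 0

/-- `#a₁a₂⋯aₖ(x)`: the number of sites of the periodic lattice at which the local pattern
`a₁a₂⋯aₖ` starts in `x`. -/
def patternCount {L : ℕ} [NeZero L] (a : List Bool) (x : Config L) : ℕ :=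
  (Finset.univ.filter fun j : ZMod L =>
    ∀ i : Fin a.length, x (j + ((i : ℕ) : ZMod L)) = a.get i).card

/-- `#010(x)`. -/
def count010 {L : ℕ} [NeZero L] (x : Config L) : ℕ :=
  patternCount [false, true, false] x

/-- `#1110(x)`. -/
def count1110 {L : ℕ} [NeZero L] (x : Config L) : ℕ :=
  patternCount [true, true, true, false] x

/-- `N_Ω(k₁,k₂)`: the number of `x ∈ Ω` with `#1110(x) = k₁` and `#010(x) = k₂`. -/
noncomputable def partitionCount {L : ℕ} [NeZero L] (Ω : Set (Config L)) (k₁ k₂ : ℕ) : ℕ :=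
  {x ∈ Ω | count1110 x = k₁ ∧ count010 x = k₂}.ncard

/-- The normalizing sum over all `k₁, k₂`. Pattern counts are at most `L`, so `N_Ω(k₁,k₂) = 0`
outside `0 ≤ k₁, k₂ ≤ L`. -/
noncomputable def normalization {L : ℕ} [NeZero L] (α : ℝ) (Ω : Set (Config L)) : ℝ :=
  ∑ k₁ ∈ Finset.range (L + 1), ∑ k₂ ∈ Finset.range (L + 1),
    α ^ k₂ / (1 - α) ^ (k₁ + k₂) * (partitionCount Ω k₁ k₂ : ℝ)

end FiveNeighborCA

namespace FiveNeighborCA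

/-! Put r = α/(1-α). The claimed weight is r^#010 (1+r)^#1110, a product of local factors chosen so
that (weight of `x'`) × (probability of the hop pattern `m` from `x'`) is r to the number of hops,
or 0 if `m` is impossible (`siteWeight_mul_sum`, `weight_mul_transition`). Hops possible before a
move are possible for the mirror-image dynamics after it (`compat_reflect`), and the weight is
mirror symmetric because #1110 = #0111 (`count1110_eq`). Summing r^hops over the mirror-possible
patterns at `x` gives the weight of `x`, and this bounds the inflow into `x`. Total inflow equals
total weight, so each bound is an equality: the weight is stationary. A positive stationary weight
makes every state recurrent, so no transition crosses the boundary of a component and the weight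
restricted to it stays stationary. A minimum-ratio argument gives uniqueness. -/

/-- The flux as a Boolean. -/
def hop (b : Bool) : Bool → Bool → Bool → Bool → Bool
  | true, true, true, false => b
  | true, false, true, false => true
  | false, false, true, false => true
  | _, _, _, _ => false

theorem flux_eq_hop (b w x y z : Bool) : flux b w x y z = (hop b w x y z).toInt := by
  revert b w x y z; decide

/-- The bonds across which a particle hops. -/
def hops {L : ℕ} (b : ZMod L → Bool) (v : Config L) (j : ZMod L) : Bool :=
  hop (b j) (v (j - 2)) (v (j - 1)) (v j) (v (j + 1))

/-- `v'` arises from `v` by moving a particle across every bond in `m`. -/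
def IsMoved {L : ℕ} (v : Config L) (m : ZMod L → Bool) (v' : Config L) : Prop :=
  ∀ j, (v' j).toInt = (v j).toInt + (m (j - 1)).toInt - (m j).toInt

theorem toInt_injective : Function.Injective Bool.toInt := by decide

theorem update_eq_iff {L : ℕ} (b : ZMod L → Bool) (v v' : Config L) :
    update b v = v' ↔ IsMoved v (hops b v) v' := by
  have h : ∀ j, (update b v j).toInt
      = (v j).toInt + (hops b v (j - 1)).toInt - (hops b v j).toInt := fun j => by
    rw [update_toInt]; simp only [bondFlux, flux_eq_hop, hops]
  constructor
  · rintro rfl; exact h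
  · intro H; funext j; exact toInt_injective ((h j).trans (H j).symm)

/-- Hence each hop pattern contributes at most one predecessor to the inflow into `v'`. -/
theorem IsMoved.source_unique {L : ℕ} {v w v' : Config L} {m : ZMod L → Bool}
    (hv : IsMoved v m v') (hw : IsMoved w m v') : v = w := by
  funext j; apply toInt_injective; linarith [hv j, hw j]

/-! ### Reflection of possible hops -/

/-- A hop (or its absence) is possible in the given neighbourhood. -/
def Compat (w x y z c : Bool) : Prop := ∃ b, hop b w x y z = c

instance (w x y z c : Bool) : Decidable (Compat w x y z c) :=
  inferInstanceAs (Decidable (∃ b, hop b w x y z = c))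

/-- A finite check on the eight sites j-3, …, j+4. Hypotheses are interleaved with quantifiers so
that `decide` prunes impossible cases early. -/
theorem compat_reflect_local : ∀ a m0 m1, ∀ x3 x2 x1 y0, Compat x3 x2 x1 y0 m0 →
    ∀ y1, Compat x2 x1 y0 y1 m1 → (a : Bool).toInt = y0.toInt + m0.toInt - m1.toInt →
    ∀ y2 m2, Compat x1 y0 y1 y2 m2 → ∀ b : Bool, b.toInt = y1.toInt + m1.toInt - m2.toInt →
    ∀ y3 m3, Compat y0 y1 y2 y3 m3 → ∀ c : Bool, c.toInt = y2.toInt + m2.toInt - m3.toInt →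
    ∀ y4 m4, Compat y1 y2 y3 y4 m4 → ∀ d : Bool, d.toInt = y3.toInt + m3.toInt - m4.toInt →
    Compat d c b a m1 := by
  decide

/-- Hops possible before the move are possible for the spatially reflected dynamics after it. -/
theorem compat_reflect {L : ℕ} {v v' : Config L} {m : ZMod L → Bool}
    (hc : ∀ j, Compat (v (j - 2)) (v (j - 1)) (v j) (v (j + 1)) (m j)) (hm : IsMoved v m v')
    (j : ZMod L) : Compat (v' (j + 3)) (v' (j + 2)) (v' (j + 1)) (v' j) (m j) := by
  refine compat_reflect_local (v' j) (m (j - 1)) (m j) (v (j - 3)) (v (j - 2)) (v (j - 1)) (v j)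
    ?_ (v (j + 1)) (hc j) (hm j) (v (j + 2)) (m (j + 1)) ?_ (v' (j + 1)) ?_
    (v (j + 3)) (m (j + 2)) ?_ (v' (j + 2)) ?_ (v (j + 4)) (m (j + 3)) ?_ (v' (j + 3)) ?_
  · convert hc (j - 1) using 2 <;> ring
  · convert hc (j + 1) using 2 <;> ring
  · convert hm (j + 1) using 4; ring_nf
  · convert hc (j + 2) using 2 <;> ring
  · convert hm (j + 2) using 4; ring_nf
  · convert hc (j + 3) using 2 <;> ring
  · convert hm (j + 3) using 4; ring_nf

/-! ### Local factors of the weight -/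

/-- The weight of a possible hop: `r` if it happens and `1` if it does not. -/
noncomputable def hopWeight (r : ℝ) (w x y z c : Bool) : ℝ :=
  if Compat w x y z c then (if c then r else 1) else 0

/-- The local factor of the stationary weight. -/
noncomputable def siteWeight (r : ℝ) (w x y z : Bool) : ℝ :=
  (if x = false ∧ y = true ∧ z = false then r else 1) *
    (if w = true ∧ x = true ∧ y = true ∧ z = false then 1 + r else 1)

theorem sum_hopWeight (r : ℝ) (w x y z : Bool) :
    ∑ c, hopWeight r w x y z c = siteWeight r w x y z := by
  cases w <;> cases x <;> cases y <;> cases z <;>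
    simp [hopWeight, siteWeight, Compat, hop]
  ring

/-- This fixes r: at 1110, (1+r)α = r and (1+r)(1-α) = 1, while the certain hop at 010 carries r. -/
theorem siteWeight_mul_sum {α : ℝ} (hα : α < 1) (w x y z c : Bool) :
    siteWeight (α / (1 - α)) w x y z *
        ∑ b, (if hop b w x y z = c then (if b then α else 1 - α) else 0)
      = hopWeight (α / (1 - α)) w x y z c := by
  have h : 1 - α ≠ 0 := by linarith
  cases w <;> cases x <;> cases y <;> cases z <;> cases c <;>
    simp [hopWeight, siteWeight, Compat, hop] <;> field_simp <;> ring

theorem hopWeight_nonneg {r : ℝ} (hr : 0 ≤ r) (w x y z c : Bool) :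
    0 ≤ hopWeight r w x y z c := by
  unfold hopWeight; split_ifs <;> norm_num [hr]

/-- The stationary weight. -/
noncomputable def weight {L : ℕ} [NeZero L] (α : ℝ) (x : Config L) : ℝ :=
  α ^ count010 x / (1 - α) ^ (count1110 x + count010 x)

theorem weight_pos {L : ℕ} [NeZero L] {α : ℝ} (hα₀ : 0 < α) (hα₁ : α < 1) (x : Config L) :
    0 < weight α x := by
  have : 0 < 1 - α := by linarith
  unfold weight; positivity

theorem prod_ite_pattern {L : ℕ} [NeZero L] (a : List Bool) (x : Config L) (r : ℝ) :
    ∏ j : ZMod L, (if ∀ i : Fin a.length, x (j + ((i : ℕ) : ZMod L)) = a.get i then r else 1)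
      = r ^ patternCount a x := by
  rw [Finset.prod_ite, Finset.prod_const, Finset.prod_const_one, mul_one, patternCount]

theorem weight_eq_pow {L : ℕ} [NeZero L] {α : ℝ} (hα : α < 1) (x : Config L) :
    weight α x = (α / (1 - α)) ^ count010 x * (1 + α / (1 - α)) ^ count1110 x := by
  have h : 1 - α ≠ 0 := by linarith
  have h' : 1 + α / (1 - α) = 1 / (1 - α) := by field_simp; ring
  rw [weight, h', div_pow, div_pow, one_pow, pow_add]; field_simp

theorem pow_count010 {L : ℕ} [NeZero L] (x : Config L) (r : ℝ) :
    ∏ j, (if x j = false ∧ x (j + 1) = true ∧ x (j + 2) = false then r else 1)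
      = r ^ count010 x := by
  rw [count010, ← prod_ite_pattern]
  refine Finset.prod_congr rfl fun j _ => ?_
  simp [Fin.forall_fin_succ, one_add_one_eq_two]

theorem weight_eq_prod {L : ℕ} [NeZero L] {α : ℝ} (hα : α < 1) (x : Config L) :
    weight α x = ∏ j, siteWeight (α / (1 - α)) (x (j - 2)) (x (j - 1)) (x j) (x (j + 1)) := by
  unfold siteWeight
  rw [Finset.prod_mul_distrib, weight_eq_pow hα, ← pow_count010, count1110, ← prod_ite_pattern]
  congr 1
  · rw [← (Equiv.subRight (1 : ZMod L)).prod_comp]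
    refine Finset.prod_congr rfl fun j _ => ?_
    have e2 : j - 1 + 2 = j + 1 := by ring
    simp [e2]
  · rw [← (Equiv.subRight (2 : ZMod L)).prod_comp]
    refine Finset.prod_congr rfl fun j _ => ?_
    have e1 : j - 2 + 1 = j - 1 := by ring
    have e2 : j - 2 + 2 = j := by ring
    have e3 : j - 2 + 3 = j + 1 := by ring
    simp [Fin.forall_fin_succ, one_add_one_eq_two, two_add_one_eq_three, e1, e2, e3]

/-- Every maximal run of at least three particles has a front and a back. -/
theorem count1110_eq {L : ℕ} [NeZero L] (x : Config L) :
    count1110 x = patternCount [false, true, true, true] x := by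
  -- Split the occurrences of 111 by the site to their right; `h2` splits them by the site to their
  -- left.
  have h1 : count1110 x + patternCount [true, true, true, true] x
      = patternCount [true, true, true] x := by
    simp only [count1110, patternCount, Finset.card_filter, ← Finset.sum_add_distrib]
    refine Finset.sum_congr rfl fun j _ => ?_
    simp only [List.length_cons, List.length_nil, Fin.forall_fin_succ]
    rcases h : x (j + 3) <;> simp [h]
  have h2 : patternCount [false, true, true, true] x + patternCount [true, true, true, true] x
      = patternCount [true, true, true] x := by
    simp only [patternCount, Finset.card_filter, ← Finset.sum_add_distrib]
    refine Fintype.sum_equiv (Equiv.addRight (1 : ZMod L)) _ _ fun j => ?_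
    have e2 : j + 1 + 1 = j + 2 := by ring
    have e3 : j + 1 + 2 = j + 3 := by ring
    rcases h : x j <;>
      simp [Fin.forall_fin_succ, one_add_one_eq_two, two_add_one_eq_three, h, e2, e3]
  omega

theorem weight_eq_prod_reflect {L : ℕ} [NeZero L] {α : ℝ} (hα : α < 1) (x : Config L) :
    weight α x = ∏ j, siteWeight (α / (1 - α)) (x (j + 3)) (x (j + 2)) (x (j + 1)) (x j) := by
  unfold siteWeight
  rw [Finset.prod_mul_distrib, weight_eq_pow hα, ← pow_count010, count1110_eq, ← prod_ite_pattern]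
  congr 1 <;> refine Finset.prod_congr rfl fun j _ => ?_
  · congr 1; apply propext; tauto
  · congr 1; simp [Fin.forall_fin_succ, one_add_one_eq_two, two_add_one_eq_three]; tauto

/-! ### Stationarity of the weight -/

theorem sum_prod_hopWeight {L : ℕ} [NeZero L] {α : ℝ} (hα : α < 1) (x : Config L) :
    ∑ m : ZMod L → Bool,
      ∏ j, hopWeight (α / (1 - α)) (x (j + 3)) (x (j + 2)) (x (j + 1)) (x j) (m j)
      = weight α x := by
  rw [weight_eq_prod_reflect hα]
  simp_rw [← sum_hopWeight]
  rw [Finset.prod_univ_sum, Fintype.piFinset_univ]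

open Classical in
theorem weight_mul_transition {L : ℕ} [NeZero L] {α : ℝ} (hα : α < 1) (x' x : Config L) :
    weight α x' * transition L α x' x = ∑ m : ZMod L → Bool, if IsMoved x' m x then
      ∏ j, hopWeight (α / (1 - α)) (x' (j - 2)) (x' (j - 1)) (x' j) (x' (j + 1)) (m j) else 0 := by
  -- The joint weight of source and hop pattern factorizes over bonds, since the noise variables are
  -- independent.
  have key : ∀ m : ZMod L → Bool,
      ∏ j, hopWeight (α / (1 - α)) (x' (j - 2)) (x' (j - 1)) (x' j) (x' (j + 1)) (m j)
        = weight α x' * ∑ b, if hops b x' = m then noiseProb α b else 0 := by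
    intro m
    simp_rw [← siteWeight_mul_sum hα]
    rw [Finset.prod_mul_distrib, ← weight_eq_prod hα, Finset.prod_univ_sum,
      Fintype.piFinset_univ]
    congr 1
    refine Finset.sum_congr rfl fun b _ => ?_
    by_cases h : hops b x' = m
    · rw [if_pos h, noiseProb]
      exact Finset.prod_congr rfl fun j _ => if_pos (congrFun h j)
    · rw [if_neg h]
      obtain ⟨j, hj⟩ := Function.ne_iff.1 h
      exact Finset.prod_eq_zero (Finset.mem_univ j) (if_neg hj)
  simp_rw [key]
  simp only [transition, Matrix.of_apply, update_eq_iff]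
  -- Once the move condition no longer involves `m`, the sum over `m` collapses to the single
  -- pattern `hops b x'`.
  have : ∀ m : ZMod L → Bool, (if IsMoved x' m x then
      weight α x' * ∑ b, (if hops b x' = m then noiseProb α b else 0) else 0)
      = weight α x' * ∑ b, (if hops b x' = m then
          (if IsMoved x' (hops b x') x then noiseProb α b else 0) else 0) := by
    intro m
    split_ifs with h
    · congr 1
      refine Finset.sum_congr rfl fun b _ => ?_
      split_ifs with h1 h2
      · rfl
      · exact absurd (h1 ▸ h) h2
      · rfl
    · symm
      refine mul_eq_zero_of_right _ (Finset.sum_eq_zero fun b _ => ?_)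
      split_ifs with h1 h2
      · exact absurd (h1 ▸ h2) h
      · rfl
      · rfl
  rw [Finset.sum_congr rfl fun m _ => this m, ← Finset.mul_sum, Finset.sum_comm]
  simp

theorem sum_noiseProb {L : ℕ} [NeZero L] (α : ℝ) :
    ∑ b : ZMod L → Bool, noiseProb α b = 1 := by
  have := Finset.prod_univ_sum (fun _ : ZMod L => (Finset.univ : Finset Bool))
    (fun _ b => if b then α else 1 - α)
  rw [Fintype.piFinset_univ] at this
  unfold noiseProb
  rw [← this]; simp

theorem sum_transition {L : ℕ} [NeZero L] (α : ℝ) (x' : Config L) :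
    ∑ x, transition L α x' x = 1 := by
  simp only [transition, Matrix.of_apply]
  rw [Finset.sum_comm]
  simp [sum_noiseProb]

theorem transition_nonneg {L : ℕ} [NeZero L] {α : ℝ} (hα₀ : 0 < α) (hα₁ : α < 1)
    (x' x : Config L) : 0 ≤ transition L α x' x := by
  simp only [transition, Matrix.of_apply]
  refine Finset.sum_nonneg fun b _ => ?_
  split_ifs
  · refine Finset.prod_nonneg fun j _ => ?_
    split_ifs <;> linarith
  · rfl

open Classical in
theorem sum_weight_mul_transition_le {L : ℕ} [NeZero L] {α : ℝ} (hα₀ : 0 < α) (hα₁ : α < 1)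
    (x : Config L) : ∑ x', weight α x' * transition L α x' x ≤ weight α x := by
  have hr : 0 ≤ α / (1 - α) := div_nonneg hα₀.le (by linarith)
  rw [← sum_prod_hopWeight hα₁ x]
  simp_rw [weight_mul_transition hα₁]
  rw [Finset.sum_comm]
  refine Finset.sum_le_sum fun m _ => ?_
  have hB : 0 ≤ ∏ j, hopWeight (α / (1 - α)) (x (j + 3)) (x (j + 2)) (x (j + 1)) (x j) (m j) :=
    Finset.prod_nonneg fun j _ => hopWeight_nonneg hr _ _ _ _ _
  by_cases hm : ∃ x', IsMoved x' m x
  · obtain ⟨x', hx'⟩ := hm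
    rw [Finset.sum_eq_single x' (fun y _ hy => if_neg fun h => hy (h.source_unique hx'))
      (fun h => absurd (Finset.mem_univ _) h), if_pos hx']
    -- If `m` is possible from `x'`, both products equal r to the number of hops; otherwise the left
    -- one is 0.
    by_cases hc : ∀ j, Compat (x' (j - 2)) (x' (j - 1)) (x' j) (x' (j + 1)) (m j)
    · refine (Finset.prod_congr rfl fun j _ => ?_).le
      rw [hopWeight, hopWeight, if_pos (hc j), if_pos (compat_reflect hc hx' j)]
    · obtain ⟨j, hj⟩ := not_forall.1 hc
      rw [Finset.prod_eq_zero (Finset.mem_univ j) (if_neg hj)]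
      exact hB
  · rw [Finset.sum_eq_zero fun y _ => if_neg fun h => hm ⟨y, h⟩]
    exact hB

/-- Termwise inequalities with equal totals are equalities, so possible hops need reflecting in one
direction only. -/
theorem weight_stationary {L : ℕ} [NeZero L] {α : ℝ} (hα₀ : 0 < α) (hα₁ : α < 1)
    (x : Config L) : ∑ x', transition L α x' x * weight α x' = weight α x := by
  have htot : ∑ x, ∑ x', weight α x' * transition L α x' x = ∑ x : Config L, weight α x := by
    rw [Finset.sum_comm]
    simp_rw [← Finset.mul_sum, sum_transition, mul_one]
  have := (Finset.sum_eq_sum_iff_of_le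
    (fun x _ => sum_weight_mul_transition_le hα₀ hα₁ x)).1 htot x (Finset.mem_univ x)
  rw [← this]
  exact Finset.sum_congr rfl fun x' _ => mul_comm _ _

/-! ### Recurrence and irreducible components -/

theorem stepProb_nonneg {L : ℕ} [NeZero L] {α : ℝ} (hα₀ : 0 < α) (hα₁ : α < 1) (n : ℕ)
    (x y : Config L) : 0 ≤ stepProb α n x y := by
  induction n generalizing y with
  | zero => simp only [stepProb, pow_zero, Matrix.one_apply]; split_ifs <;> norm_num
  | succ n ih =>
    rw [stepProb, pow_succ, Matrix.mul_apply]
    exact Finset.sum_nonneg fun z _ => mul_nonneg (ih z) (transition_nonneg hα₀ hα₁ z y)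

/-- `x` leads to `y` with positive probability. -/
def Leads {L : ℕ} [NeZero L] (α : ℝ) (x y : Config L) : Prop := ∃ n : ℕ, 0 < stepProb α n x y

theorem Leads.refl {L : ℕ} [NeZero L] (α : ℝ) (x : Config L) : Leads α x x :=
  ⟨0, by simp [stepProb]⟩

theorem Leads.trans {L : ℕ} [NeZero L] {α : ℝ} (hα₀ : 0 < α) (hα₁ : α < 1) {x y z : Config L}
    (hxy : Leads α x y) (hyz : Leads α y z) : Leads α x z := by
  obtain ⟨n, hn⟩ := hxy
  obtain ⟨k, hk⟩ := hyz
  refine ⟨n + k, ?_⟩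
  rw [stepProb, pow_add, Matrix.mul_apply]
  exact Finset.sum_pos' (fun w _ => mul_nonneg (stepProb_nonneg hα₀ hα₁ n x w)
    (stepProb_nonneg hα₀ hα₁ k w z)) ⟨y, Finset.mem_univ y, mul_pos hn hk⟩

theorem leads_of_transition_pos {L : ℕ} [NeZero L] {α : ℝ} {x y : Config L}
    (h : 0 < transition L α x y) : Leads α x y :=
  ⟨1, by simpa [stepProb] using h⟩

/-- As the weight is positive and stationary, no probability flows into a closed set. -/
theorem mem_of_transition_pos {L : ℕ} [NeZero L] {α : ℝ} (hα₀ : 0 < α) (hα₁ : α < 1)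
    (C : Set (Config L)) (hC : ∀ x ∈ C, ∀ y, 0 < transition L α x y → y ∈ C)
    {x y : Config L} (hy : y ∈ C) (h : 0 < transition L α x y) : x ∈ C := by
  classical
  by_contra hx
  -- The indicator of a closed set cannot decrease in mean over one step. Its mean under the
  -- stationary weight is constant, which contradicts a strict gain at `x`.
  let g : Config L → ℝ := fun z => if z ∈ C then 1 else 0
  have hg : ∀ z, g z ≤ ∑ w, transition L α z w * g w := by
    intro z
    by_cases hz : z ∈ C
    · simp only [g, if_pos hz]
      refine (sum_transition α z).symm.le.trans (Finset.sum_le_sum fun w _ => ?_)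
      by_cases hw : w ∈ C
      · simp [hw]
      · have := mt (hC z hz w) hw
        simpa [hw] using this
    · simp only [g, if_neg hz]
      refine Finset.sum_nonneg fun w _ => mul_nonneg (transition_nonneg hα₀ hα₁ z w) ?_
      split_ifs <;> norm_num
  have hgx : g x < ∑ w, transition L α x w * g w := by
    simp only [g, if_neg hx]
    refine Finset.sum_pos' (fun w _ => mul_nonneg (transition_nonneg hα₀ hα₁ x w) ?_)
      ⟨y, Finset.mem_univ y, by simpa [hy] using h⟩
    split_ifs <;> norm_num
  have hlt : ∑ z, weight α z * g z < ∑ z, weight α z * ∑ w, transition L α z w * g w :=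
    Finset.sum_lt_sum (fun z _ => mul_le_mul_of_nonneg_left (hg z) (weight_pos hα₀ hα₁ z).le)
      ⟨x, Finset.mem_univ x, mul_lt_mul_of_pos_left hgx (weight_pos hα₀ hα₁ x)⟩
  refine hlt.ne ?_
  simp_rw [Finset.mul_sum]
  rw [Finset.sum_comm]
  refine Finset.sum_congr rfl fun w _ => ?_
  rw [← weight_stationary hα₀ hα₁ w, Finset.sum_mul]
  exact Finset.sum_congr rfl fun z _ => by ring

/-- Every configuration is recurrent. -/
theorem leads_of_transition_pos_reverse {L : ℕ} [NeZero L] {α : ℝ} (hα₀ : 0 < α) (hα₁ : α < 1)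
    {x y : Config L} (h : 0 < transition L α x y) : Leads α y x :=
  mem_of_transition_pos hα₀ hα₁ {z | Leads α y z}
    (fun _ hz _ hw => Leads.trans hα₀ hα₁ hz (leads_of_transition_pos hw)) (Leads.refl α y) h

namespace IsIrreducibleComponent

variable {L : ℕ} [NeZero L] {α : ℝ} {Ω : Set (Config L)}

theorem nonempty (hΩ : IsIrreducibleComponent α Ω) : Ω.Nonempty := by
  by_contra h
  rw [Set.not_nonempty_iff_eq_empty] at h
  have hirr : IsIrreducible α ({fun _ => false} : Set (Config L)) := by
    rintro x rfl y rfl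
    exact Leads.refl α _
  have := hΩ.2 hirr (by simp [h]) rfl
  simp [h] at this

theorem mem_of_leads (hα₀ : 0 < α) (hα₁ : α < 1) (hΩ : IsIrreducibleComponent α Ω)
    {x y : Config L} (hx : x ∈ Ω) (hxy : Leads α x y) (hyx : Leads α y x) : y ∈ Ω := by
  refine hΩ.2 (y := insert y Ω) ?_ (Set.subset_insert y Ω) (Set.mem_insert y Ω)
  rintro u (rfl | hu) v (rfl | hv)
  · exact Leads.refl α _
  · exact Leads.trans hα₀ hα₁ hyx (hΩ.1 x hx v hv)
  · exact Leads.trans hα₀ hα₁ (hΩ.1 u hu x hx) hxy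
  · exact hΩ.1 u hu v hv

theorem mem_iff_of_transition_pos (hα₀ : 0 < α) (hα₁ : α < 1) (hΩ : IsIrreducibleComponent α Ω)
    {x y : Config L} (h : 0 < transition L α x y) : x ∈ Ω ↔ y ∈ Ω := by
  have h1 := leads_of_transition_pos h
  have h2 := leads_of_transition_pos_reverse hα₀ hα₁ h
  exact ⟨fun hx => hΩ.mem_of_leads hα₀ hα₁ hx h1 h2, fun hy => hΩ.mem_of_leads hα₀ hα₁ hy h2 h1⟩

open Classical in
theorem restrict_stationary (hα₀ : 0 < α) (hα₁ : α < 1) (hΩ : IsIrreducibleComponent α Ω)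
    (x : Config L) :
    ∑ x', transition L α x' x * (if x' ∈ Ω then weight α x' else 0)
      = if x ∈ Ω then weight α x else 0 := by
  have h : ∀ x', transition L α x' x * (if x' ∈ Ω then weight α x' else 0)
      = if x ∈ Ω then transition L α x' x * weight α x' else 0 := by
    intro x'
    rcases (transition_nonneg hα₀ hα₁ x' x).eq_or_lt with h0 | h0
    · simp [← h0]
    · simp only [hΩ.mem_iff_of_transition_pos hα₀ hα₁ h0, mul_ite, mul_zero]
  rw [Finset.sum_congr rfl fun x' _ => h x']
  split_ifs
  · exact weight_stationary hα₀ hα₁ x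
  · simp

end IsIrreducibleComponent

/-! ### Uniqueness on a component -/

theorem stepProb_stationary {L : ℕ} [NeZero L] {α : ℝ} {h : Config L → ℝ}
    (hst : ∀ x, ∑ x', transition L α x' x * h x' = h x) (n : ℕ) (x : Config L) :
    ∑ x', stepProb α n x' x * h x' = h x := by
  induction n generalizing x with
  | zero => simp [stepProb, Matrix.one_apply]
  | succ n ih =>
    have hy : ∀ y, transition L α y x * h y
        = ∑ x', transition L α y x * (stepProb α n x' y * h x') := fun y => by
      rw [← Finset.mul_sum, ih]
    rw [← hst x, Finset.sum_congr rfl fun y _ => hy y, Finset.sum_comm]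
    refine Finset.sum_congr rfl fun y _ => ?_
    rw [stepProb, pow_succ, Matrix.mul_apply, Finset.sum_mul]
    exact Finset.sum_congr rfl fun z _ => by rw [stepProb]; ring

/-- The zeros of a nonnegative stationary vector propagate backwards. -/
theorem eq_zero_of_leads {L : ℕ} [NeZero L] {α : ℝ} (hα₀ : 0 < α) (hα₁ : α < 1)
    {h : Config L → ℝ} (hst : ∀ x, ∑ x', transition L α x' x * h x' = h x)
    (hnn : ∀ x, 0 ≤ h x) {x' x : Config L} (hl : Leads α x' x) (hx : h x = 0) : h x' = 0 := by
  obtain ⟨n, hn⟩ := hl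
  have hs := stepProb_stationary hst n x
  rw [hx, Finset.sum_eq_zero_iff_of_nonneg
    (fun y _ => mul_nonneg (stepProb_nonneg hα₀ hα₁ n y x) (hnn y))] at hs
  exact (mul_eq_zero.1 (hs x' (Finset.mem_univ x'))).resolve_left hn.ne'

open Classical in
/-- A stationary probability vector on a component is proportional to the weight. -/
theorem IsStationaryOn.exists_eq_mul {L : ℕ} [NeZero L] {α : ℝ} (hα₀ : 0 < α) (hα₁ : α < 1)
    {Ω : Set (Config L)} (hΩ : IsIrreducibleComponent α Ω) {p : Config L → ℝ}
    (hp : IsStationaryOn α Ω p) : ∃ t, ∀ x, p x = t * if x ∈ Ω then weight α x else 0 := by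
  -- With `t` the least ratio, p - t·weight on `Ω` is nonnegative and stationary and vanishes at
  -- `x₀`, hence on all of `Ω`.
  obtain ⟨x₀, hx₀, hmin⟩ := Ω.toFinite.exists_minimalFor (fun x => p x / weight α x) Ω hΩ.nonempty
  set t := p x₀ / weight α x₀ with ht
  have hle : ∀ x ∈ Ω, t ≤ p x / weight α x := fun x hx =>
    (le_total t (p x / weight α x)).elim id fun h => hmin hx h
  have hnn : ∀ x, 0 ≤ p x - t * if x ∈ Ω then weight α x else 0 := by
    intro x
    split_ifs with hx
    · have := (le_div_iff₀ (weight_pos hα₀ hα₁ x)).1 (hle x hx)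
      linarith
    · simpa using hp.nonneg x
  have hst : ∀ x, ∑ x', transition L α x' x * (p x' - t * if x' ∈ Ω then weight α x' else 0)
      = p x - t * if x ∈ Ω then weight α x else 0 := by
    intro x
    rw [← hΩ.restrict_stationary hα₀ hα₁ x, ← hp.stationary x, Finset.mul_sum,
      ← Finset.sum_sub_distrib]
    exact Finset.sum_congr rfl fun x' _ => by ring
  have h0 : p x₀ - t * (if x₀ ∈ Ω then weight α x₀ else 0) = 0 := by
    rw [if_pos hx₀, ht, div_mul_cancel₀ _ (weight_pos hα₀ hα₁ x₀).ne', sub_self]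
  refine ⟨t, fun x => ?_⟩
  by_cases hx : x ∈ Ω
  · exact sub_eq_zero.1 (eq_zero_of_leads hα₀ hα₁ hst hnn (hΩ.1 x hx x₀ hx₀) h0)
  · rw [hp.support x hx, if_neg hx, mul_zero]

/-! ### Normalization -/

theorem patternCount_le {L : ℕ} [NeZero L] (a : List Bool) (x : Config L) :
    patternCount a x ≤ L :=
  (Finset.card_le_univ _).trans_eq (ZMod.card L)

open Classical in
theorem normalization_eq_sum {L : ℕ} [NeZero L] (α : ℝ) (Ω : Set (Config L)) :
    normalization α Ω = ∑ x, if x ∈ Ω then weight α x else 0 := by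
  have hN : ∀ k₁ k₂, (partitionCount Ω k₁ k₂ : ℝ)
      = ∑ x : Config L, if x ∈ Ω ∧ count1110 x = k₁ ∧ count010 x = k₂ then 1 else 0 := by
    intro k₁ k₂
    rw [partitionCount, Set.ncard_eq_toFinset_card', Set.toFinset_ofPred, Finset.sum_boole]
  simp_rw [normalization, hN, Finset.mul_sum]
  rw [Finset.sum_congr rfl fun k₁ _ => Finset.sum_comm, Finset.sum_comm]
  refine Finset.sum_congr rfl fun x _ => ?_
  have h1 : count1110 x ∈ Finset.range (L + 1) :=
    Finset.mem_range.2 (Nat.lt_succ_of_le (patternCount_le _ x))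
  have h2 : count010 x ∈ Finset.range (L + 1) :=
    Finset.mem_range.2 (Nat.lt_succ_of_le (patternCount_le _ x))
  rw [Finset.sum_eq_single_of_mem _ h1, Finset.sum_eq_single_of_mem _ h2]
  · simp [weight]
  · intro k _ hk
    simp [hk.symm]
  · intro k _ hk
    simp [hk.symm]

end FiveNeighborCA

theorem theorem4p1 (L : ℕ) [NeZero L] (α : ℝ) (hα₀ : 0 < α) (hα₁ : α < 1)
    (Ω : Set (FiveNeighborCA.Config L)) (hΩ : FiveNeighborCA.IsIrreducibleComponent α Ω) :
    (∃! p : FiveNeighborCA.Config L → ℝ, FiveNeighborCA.IsStationaryOn α Ω p) ∧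
    ∀ p : FiveNeighborCA.Config L → ℝ, FiveNeighborCA.IsStationaryOn α Ω p → ∀ x ∈ Ω,
      p x =
        (α ^ FiveNeighborCA.count010 x /
            (1 - α) ^ (FiveNeighborCA.count1110 x + FiveNeighborCA.count010 x)) /
          FiveNeighborCA.normalization α Ω := by
  classical
  open FiveNeighborCA in
  have hform : ∀ p : Config L → ℝ, IsStationaryOn α Ω p →
      ∀ x, p x = (if x ∈ Ω then weight α x else 0) / normalization α Ω := by
    intro p hp x
    obtain ⟨t, ht⟩ := hp.exists_eq_mul hα₀ hα₁ hΩ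
    have h1 : t * normalization α Ω = 1 := by
      rw [normalization_eq_sum, Finset.mul_sum, ← hp.sum_eq_one]
      exact Finset.sum_congr rfl fun x _ => (ht x).symm
    rw [ht x, eq_div_iff (right_ne_zero_of_mul_eq_one h1), mul_right_comm, h1, one_mul]
  open FiveNeighborCA in
  have hnn : ∀ x, 0 ≤ if x ∈ Ω then weight α x else 0 := fun x => by
    split_ifs
    · exact (weight_pos hα₀ hα₁ x).le
    · exact le_rfl
  open FiveNeighborCA in
  have hpos : 0 < normalization α Ω := by
    obtain ⟨x, hx⟩ := hΩ.nonempty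
    rw [normalization_eq_sum]
    exact Finset.sum_pos' (fun x _ => hnn x)
      ⟨x, Finset.mem_univ x, by rw [if_pos hx]; exact weight_pos hα₀ hα₁ x⟩
  refine ⟨⟨fun x => (if x ∈ Ω then FiveNeighborCA.weight α x else 0) /
    FiveNeighborCA.normalization α Ω, ⟨?_, ?_, ?_, ?_⟩, fun p hp => funext (hform p hp)⟩, ?_⟩
  · exact fun x => div_nonneg (hnn x) hpos.le
  · rw [← Finset.sum_div, ← FiveNeighborCA.normalization_eq_sum, div_self hpos.ne']
  · intro x
    simp_rw [← mul_div_assoc]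
    rw [← Finset.sum_div, hΩ.restrict_stationary hα₀ hα₁ x]
  · intro x hx
    simp [hx]
  · intro p hp x hx
    rw [hform p hp x, if_pos hx, FiveNeighborCA.weight]
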